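/- Let $\mathcal H,\mathcal K$ be complex Hilbert spaces and let $A,X\in\mathcal B(\mathcal H,\mathcal K)$ be bounded linear operators with $A\neq 0$. Let $E_{A^*A}$ be the spectral measure of the self-adjoint operator $A^*A$ on $\mathcal H$ and, for $\delta>0$, let $H_\delta(A)\subseteq\mathcal H$ be the range of the spectral projection $E_{A^*A}\big([\|A\|^2-\delta,\|A\|^2]\big)$. Then for every $\delta>0$ the set $\{\operatorname{Re}\langle X\phi,A\phi\rangle : \phi\in H_\delta(A),\ \|\phi\|=1\}$ is nonempty and bounded above, its suprema over all $\delta>0$ are bounded below, the limit below exists, and $$\lim_{t\to 0^+}\frac{\|A+tX\|-\|A\|}{t}=\frac{1}{\|A\|}\,\inf_{\delta>0}\ \sup_{\substack{\phi\in H_\delta(A)\\ \|\phi\|=1}}\operatorname{Re}\langle X\phi,A\phi\rangle .$$ -/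

import Mathlib

open MeasureTheory Filter Topology

universe u v

section SpectralMeasure

variable {H : Type u} [NormedAddCommGroup H] [InnerProductSpace ℂ H] [CompleteSpace H]

/-- A projection-valued measure on the Borel sets of the real line, acting on a complex Hilbert
space `H`. Only the values at Borel sets carry meaning. -/
structure ProjectionValuedMeasure (H : Type u) [NormedAddCommGroup H] [InnerProductSpace ℂ H]
    [CompleteSpace H] where
  /-- The operator attached to a set. -/
  proj : Set ℝ → (H →L[ℂ] H)
  /-- The values are orthogonal projections. -/
  isStarProjection : ∀ S, MeasurableSet S → IsStarProjection (proj S)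
  /-- The whole line has value the identity. -/
  proj_univ : proj Set.univ = 1
  /-- Intersections go to products. -/
  proj_inter : ∀ S T, MeasurableSet S → MeasurableSet T → proj (S ∩ T) = proj S * proj T
  /-- Countable additivity in the strong operator topology. -/
  hasSum_iUnion : ∀ S : ℕ → Set ℝ, (∀ n, MeasurableSet (S n)) →
    Pairwise (Function.onFun Disjoint S) →
    ∀ φ : H, HasSum (fun n => proj (S n) φ) (proj (⋃ n, S n) φ)

theorem norm_sq_starProjection {P : H →L[ℂ] H} (hP : IsStarProjection P) (φ : H) :
    (inner ℂ φ (P φ)).re = ‖P φ‖ ^ 2 := by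
  have h1 : P (P φ) = P φ := by
    have := congrArg (fun Q : H →L[ℂ] H => Q φ) hP.isIdempotentElem.eq
    simpa using this
  have h2 : inner ℂ φ (P (P φ)) = inner ℂ (P φ) (P φ) := by
    rw [← ContinuousLinearMap.adjoint_inner_left, ← ContinuousLinearMap.star_eq_adjoint,
      hP.isSelfAdjoint.star_eq]
  rw [h1] at h2
  rw [h2]
  exact inner_self_eq_norm_sq (𝕜 := ℂ) _

namespace ProjectionValuedMeasure

theorem proj_empty (E : ProjectionValuedMeasure H) : E.proj ∅ = 0 := by
  ext φ
  have h := E.hasSum_iUnion (fun _ => ∅) (fun _ => MeasurableSet.empty)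
    (fun i j _ => by simp [Function.onFun]) φ
  simp only [Set.iUnion_empty] at h
  have := h.summable.tendsto_atTop_zero
  simpa using tendsto_nhds_unique tendsto_const_nhds this

theorem inner_proj (E : ProjectionValuedMeasure H) {S : Set ℝ} (hS : MeasurableSet S) (φ : H) :
    (inner ℂ φ (E.proj S φ)).re = ‖E.proj S φ‖ ^ 2 :=
  norm_sq_starProjection (E.isStarProjection S hS) φ

/-- The scalar measure `S ↦ ⟨E(S)φ, φ⟩` of a vector `φ`. -/
noncomputable def scalarMeasure (E : ProjectionValuedMeasure H) (φ : H) : Measure ℝ :=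
  Measure.ofMeasurable (fun S _ => ENNReal.ofReal (inner ℂ φ (E.proj S φ)).re)
    (by simp [E.proj_empty])
    (by
      intro S hS hd
      have h := (Complex.reCLM.hasSum
        ((innerSL ℂ φ).hasSum (E.hasSum_iUnion S hS hd φ)))
      simp only [innerSL_apply_apply, Complex.reCLM_apply] at h
      rw [← h.tsum_eq, ENNReal.ofReal_tsum_of_nonneg _ h.summable]
      intro n
      rw [E.inner_proj (hS n)]
      positivity)

theorem scalarMeasure_apply (E : ProjectionValuedMeasure H) (φ : H) {S : Set ℝ}
    (hS : MeasurableSet S) :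
    E.scalarMeasure φ S = ENNReal.ofReal (inner ℂ φ (E.proj S φ)).re :=
  Measure.ofMeasurable_apply S hS

/-- `E` is the spectral measure of `T`: `T = ∫ x dE(x)`, that is,
`⟨Tφ, φ⟩ = ∫ x d⟨E(x)φ, φ⟩` for every vector `φ`, with convergent integrals. -/
def IsSpectralMeasureOf (E : ProjectionValuedMeasure H) (T : H →L[ℂ] H) : Prop :=
  ∀ φ : H, Integrable (fun x : ℝ => x) (E.scalarMeasure φ) ∧
    inner ℂ φ (T φ) = ((∫ x, x ∂(E.scalarMeasure φ) : ℝ) : ℂ)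

end ProjectionValuedMeasure

/-! Existence of the spectral measure of a bounded self-adjoint operator. -/

section Existence

theorem norm_sq_starAlgHom {X : Type*} [TopologicalSpace X] (Φ : C(X, ℝ) →⋆ₐ[ℝ] (H →L[ℂ] H)) (f : C(X, ℝ)) (φ : H) :
    (inner ℂ φ (Φ (f * f) φ)).re = ‖Φ f φ‖ ^ 2 := by
  have hs : star (Φ f) = Φ f := by
    rw [← map_star]; congr 1
  have h2 : inner ℂ φ (Φ f (Φ f φ)) = inner ℂ (Φ f φ) (Φ f φ) := by
    rw [← ContinuousLinearMap.adjoint_inner_left, ← ContinuousLinearMap.star_eq_adjoint, hs]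
  rw [map_mul, mul_apply_eq_comp, h2]
  exact inner_self_eq_norm_sq (𝕜 := ℂ) _

variable {X : Type*} [MetricSpace X] [CompactSpace X] [MeasurableSpace X] [BorelSpace X]

/-- The Riesz representation of `f ↦ ⟨Φ(f)φ, φ⟩`. -/
theorem exists_scalar_measure (Φ : C(X, ℝ) →⋆ₐ[ℝ] (H →L[ℂ] H)) (φ : H) :
    ∃ μ : Measure X, IsFiniteMeasure μ ∧
      ∀ f : C(X, ℝ), ∫ x, f x ∂μ = (inner ℂ φ (Φ f φ)).re := by
  let L : CompactlySupportedContinuousMap X ℝ →ₗ[ℝ] ℝ :=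
    { toFun := fun f => (inner ℂ φ (Φ f.toContinuousMap φ)).re
      map_add' := by
        intro f g
        have : (f + g).toContinuousMap = f.toContinuousMap + g.toContinuousMap := rfl
        simp [this]
      map_smul' := by
        intro c f
        have : (c • f).toContinuousMap = c • f.toContinuousMap := rfl
        rw [this, map_smul, smul_apply, ← Complex.coe_smul,
          inner_smul_right]
        simp }
  have hL : ∀ f, 0 ≤ f → 0 ≤ L f := by
    intro f hf
    let g : C(X, ℝ) := ⟨fun x => Real.sqrt (f x), by fun_prop⟩
    have hg : f.toContinuousMap = g * g := by
      ext x
      exact (Real.mul_self_sqrt (hf x)).symm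
    change 0 ≤ (inner ℂ φ (Φ f.toContinuousMap φ)).re
    rw [hg, norm_sq_starAlgHom]
    positivity
  refine ⟨RealRMK.rieszMeasure (PositiveLinearMap.mk₀ L hL), ?_, ?_⟩
  · exact ⟨isCompact_univ.measure_lt_top⟩
  · intro f
    exact RealRMK.integral_rieszMeasure (PositiveLinearMap.mk₀ L hL)
      (CompactlySupportedContinuousMap.continuousMapEquiv f)

theorem exists_indicator_vector (μ : Measure X) [IsFiniteMeasure μ]
    (L : C(X, ℝ) →ₗ[ℝ] H) (hL : ∀ f : C(X, ℝ), ‖L f‖ ^ 2 = ∫ x, f x * f x ∂μ)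
    {S : Set X} (hS : MeasurableSet S) :
    ∃ v : H, ∀ f : C(X, ℝ), ‖L f - v‖ ^ 2 = ∫ x, (f x - S.indicator 1 x) ^ 2 ∂μ := by
  have hsq : ∀ y : Lp ℝ 2 μ, ‖y‖ ^ 2 = ∫ x, (y x) ^ 2 ∂μ := by
    intro y
    rw [← real_inner_self_eq_norm_sq, L2.inner_def]
    simp [sq]
  let e : C(X, ℝ) →ₗ[ℝ] Lp ℝ 2 μ := (ContinuousMap.toLp 2 μ ℝ).toLinearMap
  have he : DenseRange e := ContinuousMap.toLp_denseRange ℝ μ ℝ (by simp)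
  have hee : ∀ f : C(X, ℝ), e f =ᵐ[μ] f := fun f => ContinuousMap.coeFn_toLp μ f
  have hn : ∀ f, ‖L f‖ = ‖e f‖ := by
    intro f
    have : ‖L f‖ ^ 2 = ‖e f‖ ^ 2 := by
      rw [hL, hsq]
      refine integral_congr_ae ?_
      filter_upwards [hee f] with x hx
      rw [hx, sq]
    exact (sq_eq_sq₀ (norm_nonneg _) (norm_nonneg _)).1 this
  have hb : ∀ f, ‖L f‖ ≤ 1 * ‖e f‖ := fun f => by rw [one_mul, hn]
  let U := L.extendOfNorm e
  have hU : ∀ f, U (e f) = L f := fun f => LinearMap.extendOfNorm_eq he ⟨1, hb⟩ f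
  have hUn : ∀ y, ‖U y‖ = ‖y‖ := by
    refine he.induction ?_ (isClosed_eq (by fun_prop) (by fun_prop))
    rintro _ ⟨f, rfl⟩
    rw [hU, hn]
  let s : Lp ℝ 2 μ := indicatorConstLp 2 hS (measure_ne_top μ S) 1
  refine ⟨U s, fun f => ?_⟩
  rw [← hU, ← map_sub, hUn, hsq]
  refine integral_congr_ae ?_
  filter_upwards [hee f, Lp.coeFn_sub (e f) s,
    indicatorConstLp_coeFn (p := 2) (hs := hS) (hμs := measure_ne_top μ S) (c := (1 : ℝ))]
    with x h1 h2 h3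
  rw [h2, Pi.sub_apply, h1, h3]
  rfl

theorem exists_indicator_approx (ν : Measure X) [IsFiniteMeasure ν] {S : Set X}
    (hS : MeasurableSet S) :
    ∃ g : ℕ → C(X, ℝ), Tendsto (fun n => ∫ x, (g n x - S.indicator 1 x) ^ 2 ∂ν) atTop (𝓝 0) := by
  have hm : MemLp (S.indicator (1 : X → ℝ)) (ENNReal.ofReal 2) ν :=
    (memLp_const (1 : ℝ)).indicator hS
  have h : ∀ n : ℕ, ∃ g : C(X, ℝ), ∫ x, (g x - S.indicator 1 x) ^ 2 ∂ν ≤ 1 / ((n : ℝ) + 1) := by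
    intro n
    obtain ⟨g, hg, -⟩ := hm.exists_boundedContinuous_integral_rpow_sub_le (by norm_num)
      (show (0 : ℝ) < 1 / ((n : ℝ) + 1) by positivity)
    refine ⟨g.toContinuousMap, le_of_eq_of_le ?_ hg⟩
    refine integral_congr_ae (ae_of_all _ fun x => ?_)
    simp only [Real.rpow_two, Real.norm_eq_abs, sq_abs]
    rw [← neg_sub, neg_sq]
    rfl
  choose g hg using h
  refine ⟨g, squeeze_zero (fun n => integral_nonneg fun x => sq_nonneg _) hg ?_⟩
  exact tendsto_one_div_add_atTop_nhds_zero_nat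

theorem integrable_sub_indicator (μ : Measure X) [IsFiniteMeasure μ] {S : Set X}
    (hS : MeasurableSet S) (f : C(X, ℝ)) :
    Integrable (fun x => (f x - S.indicator 1 x) ^ 2) μ := by
  obtain ⟨C, hC⟩ := isCompact_univ.exists_bound_of_continuousOn f.continuous.continuousOn
  have hm : Measurable (S.indicator (1 : X → ℝ)) := measurable_one.indicator hS
  refine Integrable.of_bound (C := (C + 1) ^ 2)
    ((f.continuous.measurable.sub hm).pow_const 2).aestronglyMeasurable (ae_of_all _ fun x => ?_)
  have h1 := hC x (Set.mem_univ x)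
  have h2 : ‖S.indicator (1 : X → ℝ) x‖ ≤ 1 := by
    by_cases hx : x ∈ S <;> simp [hx]
  rw [norm_pow]
  gcongr
  exact (norm_sub_le _ _).trans (add_le_add h1 h2)

theorem tendsto_of_le_measure (Φ : C(X, ℝ) →⋆ₐ[ℝ] (H →L[ℂ] H)) {μ ν : Measure X}
    [IsFiniteMeasure ν] (hle : μ ≤ ν) {S : Set X} (hS : MeasurableSet S) {g : ℕ → C(X, ℝ)}
    (hg : Tendsto (fun n => ∫ x, (g n x - S.indicator 1 x) ^ 2 ∂ν) atTop (𝓝 0)) {φ v : H}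
    (hv : ∀ f : C(X, ℝ), ‖Φ f φ - v‖ ^ 2 = ∫ x, (f x - S.indicator 1 x) ^ 2 ∂μ) :
    Tendsto (fun n => Φ (g n) φ) atTop (𝓝 v) := by
  rw [tendsto_iff_norm_sub_tendsto_zero]
  have h : Tendsto (fun n => ‖Φ (g n) φ - v‖ ^ 2) atTop (𝓝 0) := by
    refine squeeze_zero (fun n => sq_nonneg _) (fun n => ?_) hg
    rw [hv]
    exact integral_mono_measure hle (ae_of_all _ fun x => sq_nonneg _)
      (integrable_sub_indicator ν hS (g n))
  have h2 := h.sqrt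
  simpa [Real.sqrt_sq] using h2

/-- The spectral projection of a set, with its diagonal matrix elements. -/
theorem exists_projection (Φ : C(X, ℝ) →⋆ₐ[ℝ] (H →L[ℂ] H)) (μ : H → Measure X)
    [∀ φ, IsFiniteMeasure (μ φ)]
    (hμ : ∀ φ, ∀ f : C(X, ℝ), ∫ x, f x ∂(μ φ) = (inner ℂ φ (Φ f φ)).re)
    {S : Set X} (hS : MeasurableSet S) :
    ∃ P : H →L[ℂ] H, IsStarProjection P ∧ ∀ φ, (inner ℂ φ (P φ)).re = (μ φ).real S := by
  have hV : ∀ φ, ∃ v : H, ∀ f : C(X, ℝ),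
      ‖Φ f φ - v‖ ^ 2 = ∫ x, (f x - S.indicator 1 x) ^ 2 ∂(μ φ) := by
    intro φ
    refine exists_indicator_vector (μ φ)
      { toFun := fun f => Φ f φ
        map_add' := fun f g => by simp
        map_smul' := fun c f => by simp } (fun f => ?_) hS
    rw [show (∫ x, f x * f x ∂(μ φ)) = ∫ x, (f * f) x ∂(μ φ) from rfl, hμ,
      norm_sq_starAlgHom]
    rfl
  choose V hV using hV
  have hind : ∀ φ, ∫ x, (S.indicator (1 : X → ℝ) x) ^ 2 ∂(μ φ) = (μ φ).real S := by
    intro φ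
    rw [← integral_indicator_one hS]
    refine integral_congr_ae (ae_of_all _ fun x => ?_)
    by_cases hx : x ∈ S <;> simp [hx]
  have hn : ∀ φ, ‖V φ‖ ^ 2 = (μ φ).real S := by
    intro φ
    have := hV φ 0
    simpa [hind] using this
  have huniv : ∀ φ, (μ φ).real Set.univ = ‖φ‖ ^ 2 := by
    intro φ
    have h := hμ φ 1
    rw [map_one, one_apply_eq_self] at h
    have h' : (inner ℂ φ φ).re = ‖φ‖ ^ 2 := inner_self_eq_norm_sq (𝕜 := ℂ) _
    rw [h'] at h
    simpa using h
  have hre : ∀ φ, (inner ℂ φ (V φ)).re = (μ φ).real S := by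
    intro φ
    have h1 := hV φ 1
    have h2 : ∫ x, ((1 : C(X, ℝ)) x - S.indicator 1 x) ^ 2 ∂(μ φ) = (μ φ).real Sᶜ := by
      rw [← integral_indicator_one hS.compl]
      refine integral_congr_ae (ae_of_all _ fun x => ?_)
      by_cases hx : x ∈ S <;> simp [hx]
    rw [h2, measureReal_compl hS, huniv, map_one, one_apply_eq_self,
      @norm_sub_sq ℂ] at h1
    have h3 := hn φ
    simp only [RCLike.re_to_complex] at h1
    linarith
  have hadd : ∀ φ ψ, V (φ + ψ) = V φ + V ψ := by
    intro φ ψ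
    obtain ⟨g, hg⟩ := exists_indicator_approx (μ (φ + ψ) + (μ φ + μ ψ)) hS
    have h1 := tendsto_of_le_measure Φ (Measure.le_add_right le_rfl) hS hg (hV (φ + ψ))
    have h2 := tendsto_of_le_measure Φ
      (Measure.le_add_left (Measure.le_add_right le_rfl)) hS hg (hV φ)
    have h3 := tendsto_of_le_measure Φ
      (Measure.le_add_left (Measure.le_add_left le_rfl)) hS hg (hV ψ)
    refine tendsto_nhds_unique h1 ?_
    simpa using h2.add h3
  have hsmul : ∀ (c : ℂ) φ, V (c • φ) = c • V φ := by
    intro c φ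
    obtain ⟨g, hg⟩ := exists_indicator_approx (μ (c • φ) + μ φ) hS
    have h1 := tendsto_of_le_measure Φ (Measure.le_add_right le_rfl) hS hg (hV (c • φ))
    have h2 := tendsto_of_le_measure Φ (Measure.le_add_left le_rfl) hS hg (hV φ)
    refine tendsto_nhds_unique h1 ?_
    simpa using h2.const_smul c
  have hsymm : ∀ φ ψ, inner ℂ (V φ) ψ = inner ℂ φ (V ψ) := by
    intro φ ψ
    obtain ⟨g, hg⟩ := exists_indicator_approx (μ φ + μ ψ) hS
    have h1 := tendsto_of_le_measure Φ (Measure.le_add_right le_rfl) hS hg (hV φ)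
    have h2 := tendsto_of_le_measure Φ (Measure.le_add_left le_rfl) hS hg (hV ψ)
    have h3 : Tendsto (fun n => inner ℂ (Φ (g n) φ) ψ) atTop (𝓝 (inner ℂ (V φ) ψ)) :=
      h1.inner tendsto_const_nhds
    have h4 : Tendsto (fun n => inner ℂ φ (Φ (g n) ψ)) atTop (𝓝 (inner ℂ φ (V ψ))) :=
      tendsto_const_nhds.inner h2
    refine tendsto_nhds_unique h3 (h4.congr fun n => ?_)
    rw [← ContinuousLinearMap.adjoint_inner_left, ← ContinuousLinearMap.star_eq_adjoint,
      ← map_star]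
    congr 3
  let P : H →L[ℂ] H := LinearMap.mkContinuous
    { toFun := V, map_add' := hadd, map_smul' := hsmul } 1 (fun φ => by
      rw [one_mul]
      refine (sq_le_sq₀ (norm_nonneg _) (norm_nonneg _)).1 ?_
      rw [← huniv φ]
      exact (hn φ).trans_le (measureReal_mono (Set.subset_univ S)))
  have hP : ∀ φ, P φ = V φ := fun φ => rfl
  have hsa : ∀ φ ψ, inner ℂ (P φ) ψ = inner ℂ φ (P ψ) := hsymm
  refine ⟨P, ⟨?_, ?_⟩, hre⟩
  · change P * P = P
    have : ((P * P : H →L[ℂ] H) : H →ₗ[ℂ] H) = P := by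
      rw [← ext_inner_map]
      intro φ
      change inner ℂ (P (P φ)) φ = inner ℂ (P φ) φ
      have e1 : (inner ℂ (P (P φ)) φ) = ((‖P φ‖ ^ 2 : ℝ) : ℂ) := by
        rw [hsa, inner_self_eq_norm_sq_to_K]
        simp
      have e2 : (inner ℂ (P φ) φ) = (((μ φ).real S : ℝ) : ℂ) := by
        have h5 : (starRingEnd ℂ) (inner ℂ (P φ) φ) = inner ℂ (P φ) φ := by
          rw [inner_conj_symm, hsa]
        rw [← Complex.conj_eq_iff_re.1 h5, hsa, hP, hre]
      rw [e1, e2, hP, hn]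
    exact ContinuousLinearMap.coe_injective this
  · rw [ContinuousLinearMap.isSelfAdjoint_iff_isSymmetric]
    exact hsa

theorem eq_of_re_inner_eq {P Q : H →L[ℂ] H} (hP : IsSelfAdjoint P) (hQ : IsSelfAdjoint Q)
    (h : ∀ φ, (inner ℂ φ (P φ)).re = (inner ℂ φ (Q φ)).re) : P = Q := by
  rw [ContinuousLinearMap.isSelfAdjoint_iff_isSymmetric] at hP hQ
  have : (P : H →ₗ[ℂ] H) = Q := by
    rw [← ext_inner_map]
    intro φ
    rw [← Complex.conj_eq_iff_re.1 (hP.conj_inner_sym φ φ),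
      ← Complex.conj_eq_iff_re.1 (hQ.conj_inner_sym φ φ), hP, hQ]
    exact congrArg _ (h φ)
  exact ContinuousLinearMap.coe_injective this

/-- Assembling projections with countably additive diagonal matrix elements. -/
theorem exists_pvm (m : H → Measure ℝ) [∀ φ, IsFiniteMeasure (m φ)]
    (hm : ∀ φ, (m φ).real Set.univ = ‖φ‖ ^ 2)
    (hP : ∀ S : Set ℝ, MeasurableSet S →
      ∃ P : H →L[ℂ] H, IsStarProjection P ∧ ∀ φ, (inner ℂ φ (P φ)).re = (m φ).real S) :
    ∃ E : ProjectionValuedMeasure H, ∀ φ, E.scalarMeasure φ = m φ := by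
  classical
  have hP' : ∀ S : Set ℝ, ∃ P : H →L[ℂ] H, MeasurableSet S →
      IsStarProjection P ∧ ∀ φ, (inner ℂ φ (P φ)).re = (m φ).real S := by
    intro S
    by_cases hS : MeasurableSet S
    · obtain ⟨P, h⟩ := hP S hS
      exact ⟨P, fun _ => h⟩
    · exact ⟨0, fun h => absurd h hS⟩
  choose P hP' using hP'
  have hproj : ∀ S, MeasurableSet S → IsStarProjection (P S) := fun S hS => (hP' S hS).1
  have hre : ∀ S, MeasurableSet S → ∀ φ, (inner ℂ φ (P S φ)).re = (m φ).real S :=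
    fun S hS => (hP' S hS).2
  have hn : ∀ S, MeasurableSet S → ∀ φ, ‖P S φ‖ ^ 2 = (m φ).real S := fun S hS φ => by
    rw [← hre S hS, norm_sq_starProjection (hproj S hS)]
  have hidem : ∀ S, MeasurableSet S → ∀ φ, P S (P S φ) = P S φ := fun S hS φ => by
    have := congrArg (fun Q : H →L[ℂ] H => Q φ) (hproj S hS).isIdempotentElem.eq
    simpa using this
  have hempty : P ∅ = 0 := by
    ext φ
    have := hn ∅ MeasurableSet.empty φ
    simpa using this
  have hunion : ∀ A B, MeasurableSet A → MeasurableSet B → Disjoint A B →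
      P (A ∪ B) = P A + P B := by
    intro A B hA hB hd
    refine eq_of_re_inner_eq (hproj _ (hA.union hB)).isSelfAdjoint
      ((hproj A hA).isSelfAdjoint.add (hproj B hB).isSelfAdjoint) fun φ => ?_
    rw [hre _ (hA.union hB), measureReal_union hd hB, add_apply, inner_add_right, Complex.add_re,
      hre A hA, hre B hB]
  have horth : ∀ A B, MeasurableSet A → MeasurableSet B → Disjoint A B → P A * P B = 0 := by
    intro A B hA hB hd
    ext ψ
    rw [mul_apply_eq_comp]
    have h1 : (m (P B ψ)).real (A ∪ B) ≤ ‖P B ψ‖ ^ 2 := by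
      rw [← hm]; exact measureReal_mono (Set.subset_univ _)
    rw [measureReal_union hd hB, ← hn A hA, ← hn B hB, hidem B hB] at h1
    have h2 : ‖P A (P B ψ)‖ ^ 2 = 0 := le_antisymm (by linarith) (sq_nonneg _)
    simpa using h2
  let E : ProjectionValuedMeasure H :=
    { proj := P
      isStarProjection := hproj
      proj_univ := by
        refine eq_of_re_inner_eq (hproj _ MeasurableSet.univ).isSelfAdjoint
          (IsSelfAdjoint.one _) fun φ => ?_
        rw [hre _ MeasurableSet.univ, hm]
        exact (inner_self_eq_norm_sq (𝕜 := ℂ) _).symm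
      proj_inter := by
        intro S T hS hT
        have h1 : P S = P (S \ T) + P (S ∩ T) := by
          rw [← hunion _ _ (hS.diff hT) (hS.inter hT) Set.disjoint_sdiff_inter,
            Set.sdiff_union_inter]
        have h2 : P T = P (T \ S) + P (S ∩ T) := by
          rw [← hunion _ _ (hT.diff hS) (hS.inter hT), Set.inter_comm, Set.sdiff_union_inter]
          rw [Set.inter_comm]; exact Set.disjoint_sdiff_inter
        have h3 : Disjoint (S \ T) (T \ S) :=
          Set.disjoint_left.2 fun x hx hy => hx.2 hy.1
        have h4 : Disjoint (S \ T) (S ∩ T) := Set.disjoint_left.2 fun x hx hy => hx.2 hy.2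
        have h5 : Disjoint (S ∩ T) (T \ S) := Set.disjoint_left.2 fun x hx hy => hy.2 hx.1
        rw [h1, h2, mul_add, add_mul, add_mul, horth _ _ (hS.diff hT) (hT.diff hS) h3,
          horth _ _ (hS.diff hT) (hS.inter hT) h4, horth _ _ (hS.inter hT) (hT.diff hS) h5,
          (hproj _ (hS.inter hT)).isIdempotentElem.eq]
        simp
      hasSum_iUnion := by
        intro S hS hd φ
        have hU : MeasurableSet (⋃ n, S n) := MeasurableSet.iUnion hS
        have hF : ∀ F : Finset ℕ, MeasurableSet (⋃ n ∈ F, S n) := fun F =>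
          F.measurableSet_biUnion fun n _ => hS n
        have hsum : ∀ F : Finset ℕ, ∑ n ∈ F, P (S n) φ = P (⋃ n ∈ F, S n) φ := by
          intro F
          induction F using Finset.induction_on with
          | empty => simp [hempty]
          | insert a F ha ih =>
            rw [Finset.sum_insert ha, ih, Finset.set_biUnion_insert, hunion _ _ (hS a) (hF F)]
            · rfl
            · rw [Set.disjoint_iUnion₂_right]
              intro i hi
              exact hd (fun h => ha (h ▸ hi))
        have hdist : ∀ F : Finset ℕ, ‖(∑ n ∈ F, P (S n) φ) - P (⋃ n, S n) φ‖ ^ 2 =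
            (m φ).real (⋃ n, S n) - ∑ n ∈ F, (m φ).real (S n) := by
          intro F
          have hsub : (⋃ n ∈ F, S n) ⊆ ⋃ n, S n := Set.iUnion₂_subset_iUnion _ _
          have h1 : P (⋃ n, S n) = P ((⋃ n, S n) \ ⋃ n ∈ F, S n) + P (⋃ n ∈ F, S n) := by
            rw [← hunion _ _ (hU.diff (hF F)) (hF F) Set.disjoint_sdiff_left,
              Set.sdiff_union_of_subset hsub]
          rw [hsum, h1, add_apply, sub_add_cancel_right, norm_neg, hn _ (hU.diff (hF F)),
            measureReal_sdiff hsub (hF F),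
            measureReal_biUnion_finset (fun i _ j _ hij => hd hij) (fun i _ => hS i)]
        have hs : HasSum (fun n => (m φ).real (S n)) ((m φ).real (⋃ n, S n)) := by
          have h := measure_iUnion (μ := m φ) hd hS
          have hne : ∑' n, (m φ) (S n) ≠ ⊤ := by rw [← h]; exact measure_ne_top _ _
          have := ENNReal.hasSum_toReal hne
          rwa [← ENNReal.tsum_toReal_eq (fun n => measure_ne_top _ _), ← h] at this
        unfold HasSum
        rw [tendsto_iff_norm_sub_tendsto_zero]
        have ht : Tendsto (fun F : Finset ℕ => ‖(∑ n ∈ F, P (S n) φ) - P (⋃ n, S n) φ‖ ^ 2)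
            (SummationFilter.unconditional ℕ).filter (𝓝 0) := by
          simp_rw [hdist]
          have h2 := (tendsto_const_nhds (x := (m φ).real (⋃ n, S n))).sub hs
          simpa using h2
        have h3 := ht.sqrt
        simpa [Real.sqrt_sq] using h3 }
  refine ⟨E, fun φ => ?_⟩
  ext S hS
  rw [E.scalarMeasure_apply φ hS]
  change ENNReal.ofReal (inner ℂ φ (P S φ)).re = _
  rw [hre S hS, ofReal_measureReal]

end Existence

/-- A bounded self-adjoint operator has a spectral measure. -/
theorem exists_isSpectralMeasureOf (T : H →L[ℂ] H) (hT : IsSelfAdjoint T) :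
    ∃ E : ProjectionValuedMeasure H, E.IsSpectralMeasureOf T := by
  have : CompactSpace (spectrum ℝ T) :=
    isCompact_iff_compactSpace.1 (ContinuousFunctionalCalculus.isCompact_spectrum T)
  let Φ : C(spectrum ℝ T, ℝ) →⋆ₐ[ℝ] (H →L[ℂ] H) := cfcHom hT
  have h := fun φ => exists_scalar_measure Φ φ
  choose μ hfin hμ using h
  let m : H → Measure ℝ := fun φ => (μ φ).map Subtype.val
  have hval : Measurable (Subtype.val : spectrum ℝ T → ℝ) := measurable_subtype_coe
  have hmS : ∀ φ (S : Set ℝ), MeasurableSet S → (m φ).real S = (μ φ).real (Subtype.val ⁻¹' S) :=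
    fun φ S hS => map_measureReal_apply hval hS
  obtain ⟨E, hE⟩ := exists_pvm m
    (fun φ => by
      rw [hmS φ _ MeasurableSet.univ, Set.preimage_univ]
      have h := hμ φ 1
      rw [map_one, one_apply_eq_self] at h
      have h' : (inner ℂ φ φ).re = ‖φ‖ ^ 2 := inner_self_eq_norm_sq (𝕜 := ℂ) _
      rw [h'] at h
      simpa using h)
    (fun S hS => by
      obtain ⟨P, hP, h⟩ := exists_projection Φ μ hμ (hval hS)
      exact ⟨P, hP, fun φ => by rw [h, hmS φ S hS]⟩)
  refine ⟨E, fun φ => ?_⟩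
  rw [hE φ]
  have hid : Φ ((ContinuousMap.id ℝ).restrict (spectrum ℝ T)) = T := cfcHom_id hT
  constructor
  · refine (integrable_map_measure measurable_id.aestronglyMeasurable hval.aemeasurable).2 ?_
    exact ((ContinuousMap.id ℝ).restrict (spectrum ℝ T)).continuous.integrable_of_hasCompactSupport
      (HasCompactSupport.of_compactSpace _)
  · have h1 : ∫ x, x ∂(m φ) = ∫ x, ((ContinuousMap.id ℝ).restrict (spectrum ℝ T)) x ∂(μ φ) :=
      integral_map hval.aemeasurable measurable_id.aestronglyMeasurable
    rw [h1, hμ, hid]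
    have hsym := ContinuousLinearMap.isSelfAdjoint_iff_isSymmetric.1 hT
    have h2 : (starRingEnd ℂ) (inner ℂ φ (T φ)) = inner ℂ φ (T φ) := by
      rw [inner_conj_symm]; exact hsym φ φ
    exact (Complex.conj_eq_iff_re.1 h2).symm

/-- The spectral measure of a bounded self-adjoint operator. -/
noncomputable def spectralMeasure (T : H →L[ℂ] H) (hT : IsSelfAdjoint T) :
    ProjectionValuedMeasure H :=
  (exists_isSpectralMeasureOf T hT).choose

theorem spectralMeasure_spec (T : H →L[ℂ] H) (hT : IsSelfAdjoint T) :
    (spectralMeasure T hT).IsSpectralMeasureOf T :=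
  (exists_isSpectralMeasureOf T hT).choose_spec

variable {K : Type v} [NormedAddCommGroup K] [InnerProductSpace ℂ K] [CompleteSpace K]

/-- `H_δ(A)`: the range of the spectral projection of `A*A` for the interval
`[‖A‖² - δ, ‖A‖²]`. -/
noncomputable def spectralRange (A : H →L[ℂ] K) (δ : ℝ) : Submodule ℂ H :=
  ((spectralMeasure (ContinuousLinearMap.adjoint A ∘L A)
    (ContinuousLinearMap.isPositive_adjoint_comp_self A).isSelfAdjoint).proj
      (Set.Icc (‖A‖ ^ 2 - δ) (‖A‖ ^ 2))).range

/-- The values `Re ⟨Xφ, Aφ⟩` at the unit vectors `φ` of `H_δ(A)`. -/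
def unitValues (A X : H →L[ℂ] K) (δ : ℝ) : Set ℝ :=
  {r | ∃ φ ∈ spectralRange A δ, ‖φ‖ = 1 ∧ r = (inner ℂ (A φ) (X φ)).re}

end SpectralMeasure

/-! ### Operator bounds and the expansion of the squared norm -/

section NormDerivative

variable {H : Type u} [NormedAddCommGroup H] [InnerProductSpace ℂ H]
  {K : Type v} [NormedAddCommGroup K] [InnerProductSpace ℂ K]

/-! Squared norms are easier: `‖(A+tX)φ‖² = ‖Aφ‖² + 2t Re⟨Aφ,Xφ⟩ + t²‖Xφ‖²`. Write `s(δ)` for the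
supremum over unit vectors of `H_δ(A)`.

Lower bound (`le_norm_add_smul_sq`): unit vectors of `H_δ(A)` satisfy `‖Aφ‖² ≥ ‖A‖² - δ`, so
`‖A+tX‖² ≥ ‖A‖² - δ + 2t s(δ)`. Since `s(δ) ≥ inf s`, letting `δ → 0` at fixed `t` leaves `‖A‖² + 2t
inf s`.

Upper bound (`norm_add_smul_sq_le`): let a unit vector `φ` lie at distance `c` from its projection
to `H_δ(A)`. This costs at least `δc²` in `‖Aφ‖²` and raises the linear term above `2t s(δ)` by at
most `2tCc`, with `C = 3‖A‖‖X‖`. As `2tCc - δc² ≤ t²C²/δ`, the net gain is `O(t²)` for fixed `δ`.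

Hence the squared norm has right derivative `2 inf s` at `0`; division by `‖A+tX‖ + ‖A‖ → 2‖A‖`
gives the derivative of the norm. -/

theorem abs_re_inner_apply_le (A X : H →L[ℂ] K) (φ ψ : H) :
    |(inner ℂ (A φ) (X ψ)).re| ≤ ‖A‖ * ‖X‖ * (‖φ‖ * ‖ψ‖) := by
  refine (Complex.abs_re_le_norm _).trans ((norm_inner_le_norm _ _).trans ?_)
  refine (mul_le_mul (A.le_opNorm φ) (X.le_opNorm ψ) (norm_nonneg _) (by positivity)).trans_eq ?_
  ring

theorem norm_add_smul_apply_sq (A X : H →L[ℂ] K) (t : ℝ) (φ : H) :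
    ‖(A + (t : ℂ) • X) φ‖ ^ 2 =
      ‖A φ‖ ^ 2 + 2 * t * (inner ℂ (A φ) (X φ)).re + t ^ 2 * ‖X φ‖ ^ 2 := by
  rw [add_apply, smul_apply, @norm_add_sq ℂ, inner_smul_right, norm_smul, mul_pow]
  simp only [RCLike.re_to_complex, Complex.re_ofReal_mul, Complex.norm_real, Real.norm_eq_abs,
    sq_abs]
  ring

variable [CompleteSpace H] [CompleteSpace K]

/-! ### Scalar measures as squared norms of projections -/

namespace ProjectionValuedMeasure

theorem isFiniteMeasure_scalarMeasure (E : ProjectionValuedMeasure H) (φ : H) :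
    IsFiniteMeasure (E.scalarMeasure φ) :=
  ⟨by rw [E.scalarMeasure_apply φ MeasurableSet.univ]; exact ENNReal.ofReal_lt_top⟩

theorem scalarMeasure_real (E : ProjectionValuedMeasure H) (φ : H) {S : Set ℝ}
    (hS : MeasurableSet S) : (E.scalarMeasure φ).real S = ‖E.proj S φ‖ ^ 2 := by
  rw [measureReal_def, E.scalarMeasure_apply φ hS, E.inner_proj hS,
    ENNReal.toReal_ofReal (sq_nonneg _)]

theorem scalarMeasure_real_univ (E : ProjectionValuedMeasure H) (φ : H) :
    (E.scalarMeasure φ).real Set.univ = ‖φ‖ ^ 2 := by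
  rw [E.scalarMeasure_real φ MeasurableSet.univ, E.proj_univ, one_apply_eq_self]

theorem norm_sub_proj_sq (E : ProjectionValuedMeasure H) (φ : H) {S : Set ℝ}
    (hS : MeasurableSet S) : ‖φ - E.proj S φ‖ ^ 2 = ‖φ‖ ^ 2 - ‖E.proj S φ‖ ^ 2 := by
  have h := E.inner_proj hS φ
  rw [@norm_sub_sq ℂ]
  simp only [RCLike.re_to_complex]
  linarith

theorem scalarMeasure_real_compl (E : ProjectionValuedMeasure H) (φ : H) {S : Set ℝ}
    (hS : MeasurableSet S) : (E.scalarMeasure φ).real Sᶜ = ‖φ - E.proj S φ‖ ^ 2 := by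
  have := E.isFiniteMeasure_scalarMeasure φ
  rw [measureReal_compl hS, E.scalarMeasure_real_univ, E.scalarMeasure_real φ hS,
    E.norm_sub_proj_sq φ hS]

theorem proj_apply_of_mem_range (E : ProjectionValuedMeasure H) {S : Set ℝ}
    (hS : MeasurableSet S) {φ : H} (hφ : φ ∈ (E.proj S).range) : E.proj S φ = φ := by
  obtain ⟨ψ, rfl⟩ := hφ
  exact congrArg (fun Q : H →L[ℂ] H => Q ψ) (E.isStarProjection S hS).isIdempotentElem.eq

theorem ae_mem_of_proj_apply_eq (E : ProjectionValuedMeasure H) {S : Set ℝ}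
    (hS : MeasurableSet S) {φ : H} (hφ : E.proj S φ = φ) :
    ∀ᵐ x ∂(E.scalarMeasure φ), x ∈ S := by
  have := E.isFiniteMeasure_scalarMeasure φ
  have h := E.scalarMeasure_real_compl φ hS
  rw [hφ, sub_self, norm_zero, zero_pow two_ne_zero] at h
  exact (measureReal_eq_zero_iff).1 h

/-! ### The spectral measure of `A*A` near the top of the spectrum -/

section Gram

variable {A : H →L[ℂ] K} {E : ProjectionValuedMeasure H}
  (hE : E.IsSpectralMeasureOf (ContinuousLinearMap.adjoint A ∘L A))

include hE

theorem IsSpectralMeasureOf.integral_eq_norm_sq (φ : H) :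
    ∫ x, x ∂(E.scalarMeasure φ) = ‖A φ‖ ^ 2 := by
  have h := (hE φ).2
  rw [ContinuousLinearMap.comp_apply, ContinuousLinearMap.adjoint_inner_right,
    inner_self_eq_norm_sq_to_K] at h
  exact Complex.ofReal_injective (h.symm.trans (Complex.ofReal_pow _ _).symm)

/-- The integral formula alone confines the measure: for `φ` in the range, `x - ‖A‖²` is positive
almost everywhere, yet its integral `‖Aφ‖² - ‖A‖²‖φ‖²` is at most `0`. So the scalar measure of `φ`
vanishes, and its total mass is `‖φ‖²`. -/
theorem IsSpectralMeasureOf.proj_Ioi_norm_sq : E.proj (Set.Ioi (‖A‖ ^ 2)) = 0 := by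
  ext ψ
  have hS : MeasurableSet (Set.Ioi (‖A‖ ^ 2)) := measurableSet_Ioi
  have hφ := E.proj_apply_of_mem_range hS (φ := E.proj (Set.Ioi (‖A‖ ^ 2)) ψ) ⟨ψ, rfl⟩
  set φ := E.proj (Set.Ioi (‖A‖ ^ 2)) ψ
  have := E.isFiniteMeasure_scalarMeasure φ
  have hae := E.ae_mem_of_proj_apply_eq hS hφ
  have hint : Integrable (fun x : ℝ => x - ‖A‖ ^ 2) (E.scalarMeasure φ) :=
    (hE φ).1.sub (integrable_const _)
  have h0 : 0 ≤ᵐ[E.scalarMeasure φ] fun x : ℝ => x - ‖A‖ ^ 2 := by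
    filter_upwards [hae] with x hx
    exact sub_nonneg.2 (le_of_lt hx)
  have hval : ∫ x, (x - ‖A‖ ^ 2) ∂(E.scalarMeasure φ) = ‖A φ‖ ^ 2 - ‖A‖ ^ 2 * ‖φ‖ ^ 2 := by
    rw [integral_sub (hE φ).1 (integrable_const _), hE.integral_eq_norm_sq, integral_const,
      E.scalarMeasure_real_univ, smul_eq_mul, mul_comm (‖φ‖ ^ 2)]
  have hle : ‖A φ‖ ^ 2 ≤ ‖A‖ ^ 2 * ‖φ‖ ^ 2 := by
    rw [← mul_pow]
    exact pow_le_pow_left₀ (norm_nonneg _) (A.le_opNorm φ) 2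
  have hz := (integral_eq_zero_iff_of_nonneg_ae h0 hint).1
    (le_antisymm (by linarith) (integral_nonneg_of_ae h0))
  have hfalse : ∀ᵐ _ ∂(E.scalarMeasure φ), False := by
    filter_upwards [hae, hz] with x hx hx'
    exact absurd hx' (sub_pos.2 hx).ne'
  have hu : (E.scalarMeasure φ).real Set.univ = 0 := by
    rw [measureReal_eq_zero_iff]
    simpa [ae_iff] using hfalse
  rw [E.scalarMeasure_real_univ] at hu
  simpa using hu

theorem IsSpectralMeasureOf.ae_le_norm_sq (φ : H) :
    ∀ᵐ x ∂(E.scalarMeasure φ), x ≤ ‖A‖ ^ 2 := by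
  have := E.isFiniteMeasure_scalarMeasure φ
  have h := E.scalarMeasure_real φ (measurableSet_Ioi (a := ‖A‖ ^ 2))
  rw [hE.proj_Ioi_norm_sq, zero_apply, norm_zero, zero_pow two_ne_zero,
    measureReal_eq_zero_iff] at h
  rw [ae_iff]
  simp only [not_le]
  exact h

/-- Integrate the pointwise bound `x ≤ ‖A‖² - δ·1_{Iᶜ}(x)`, valid almost everywhere; the mass of
`Iᶜ` is the squared distance from `φ` to its projection. This is the penalty that drives the upper
bound. -/
theorem IsSpectralMeasureOf.norm_sq_le (δ : ℝ) (φ : H) :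
    ‖A φ‖ ^ 2 ≤ ‖A‖ ^ 2 * ‖φ‖ ^ 2 -
      δ * ‖φ - E.proj (Set.Icc (‖A‖ ^ 2 - δ) (‖A‖ ^ 2)) φ‖ ^ 2 := by
  have := E.isFiniteMeasure_scalarMeasure φ
  set I := Set.Icc (‖A‖ ^ 2 - δ) (‖A‖ ^ 2)
  have hI : MeasurableSet I := measurableSet_Icc
  have hind : Integrable (Iᶜ.indicator fun _ : ℝ => δ) (E.scalarMeasure φ) :=
    (integrable_const δ).indicator hI.compl
  have hle : ∫ x, x ∂(E.scalarMeasure φ) ≤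
      ∫ x, (‖A‖ ^ 2 - Iᶜ.indicator (fun _ => δ) x) ∂(E.scalarMeasure φ) := by
    refine integral_mono_ae (hE φ).1 ((integrable_const _).sub hind) ?_
    filter_upwards [hE.ae_le_norm_sq φ] with x hx
    by_cases hxI : x ∈ I
    · simpa [hxI] using hx
    · have : x < ‖A‖ ^ 2 - δ := not_le.1 fun h => hxI ⟨h, hx⟩
      simpa [hxI] using this.le
  rw [hE.integral_eq_norm_sq, integral_sub (integrable_const _) hind, integral_const,
    integral_indicator_const _ hI.compl, E.scalarMeasure_real_univ,
    E.scalarMeasure_real_compl φ hI, smul_eq_mul, smul_eq_mul] at hle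
  linarith

theorem IsSpectralMeasureOf.le_norm_sq {δ : ℝ} {φ : H}
    (hφ : E.proj (Set.Icc (‖A‖ ^ 2 - δ) (‖A‖ ^ 2)) φ = φ) :
    (‖A‖ ^ 2 - δ) * ‖φ‖ ^ 2 ≤ ‖A φ‖ ^ 2 := by
  have := E.isFiniteMeasure_scalarMeasure φ
  rw [← hE.integral_eq_norm_sq, ← E.scalarMeasure_real_univ, mul_comm, ← smul_eq_mul,
    ← integral_const]
  refine integral_mono_ae (integrable_const _) (hE φ).1 ?_
  filter_upwards [E.ae_mem_of_proj_apply_eq measurableSet_Icc hφ] with x hx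
  exact hx.1

/-- With a zero projection the penalty applies to the whole of `φ`, which forces `‖A‖² ≤ ‖A‖² - δ`.
-/
theorem IsSpectralMeasureOf.proj_Icc_ne_zero (hA : A ≠ 0) {δ : ℝ} (hδ : 0 < δ) :
    E.proj (Set.Icc (‖A‖ ^ 2 - δ) (‖A‖ ^ 2)) ≠ 0 := by
  intro h0
  have hb : ∀ φ, ‖A φ‖ ^ 2 ≤ (‖A‖ ^ 2 - δ) * ‖φ‖ ^ 2 := fun φ => by
    have h := hE.norm_sq_le δ φ
    rw [h0, zero_apply, sub_zero] at h
    linarith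
  obtain ⟨φ, hφ⟩ : ∃ φ, A φ ≠ 0 := by
    by_contra! h
    exact hA (ContinuousLinearMap.ext h)
  -- Positivity comes from a vector not killed by `A`; without it the square root below would be the
  -- default value `0`.
  have hpos : 0 < ‖A‖ ^ 2 - δ :=
    pos_of_mul_pos_left ((pow_pos (norm_pos_iff.2 hφ) 2).trans_le (hb φ)) (sq_nonneg _)
  have hn : ‖A‖ ≤ √(‖A‖ ^ 2 - δ) := by
    refine A.opNorm_le_bound (Real.sqrt_nonneg _) fun ψ => ?_
    refine abs_le_of_sq_le_sq' ?_ (by positivity) |>.2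
    rw [mul_pow, Real.sq_sqrt hpos.le]
    exact hb ψ
  have := (Real.le_sqrt (norm_nonneg A) hpos.le).1 hn
  linarith

end Gram

end ProjectionValuedMeasure

/-! ### Suprema over the spectral ranges -/

theorem abs_le_of_mem_unitValues {A X : H →L[ℂ] K} {δ r : ℝ} (hr : r ∈ unitValues A X δ) :
    |r| ≤ ‖A‖ * ‖X‖ := by
  obtain ⟨φ, -, hφ, rfl⟩ := hr
  simpa [hφ] using abs_re_inner_apply_le A X φ φ

theorem bddAbove_unitValues (A X : H →L[ℂ] K) (δ : ℝ) : BddAbove (unitValues A X δ) :=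
  ⟨‖A‖ * ‖X‖, fun _ hr => (le_abs_self _).trans (abs_le_of_mem_unitValues hr)⟩

theorem unitValues_nonempty {A : H →L[ℂ] K} (hA : A ≠ 0) (X : H →L[ℂ] K) {δ : ℝ} (hδ : 0 < δ) :
    (unitValues A X δ).Nonempty := by
  have h := (spectralMeasure_spec _ (ContinuousLinearMap.isPositive_adjoint_comp_self
    A).isSelfAdjoint).proj_Icc_ne_zero hA hδ
  obtain ⟨φ, hφ⟩ := DFunLike.ne_iff.1 h
  obtain ⟨ψ, hψ, h0⟩ : ∃ ψ ∈ spectralRange A δ, ψ ≠ 0 := ⟨_, ⟨φ, rfl⟩, hφ⟩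
  refine ⟨_, ((‖ψ‖⁻¹ : ℝ) : ℂ) • ψ, (spectralRange A δ).smul_mem _ hψ, ?_, rfl⟩
  rw [norm_smul, Complex.norm_real, norm_inv, norm_norm]
  exact inv_mul_cancel₀ (norm_ne_zero_iff.2 h0)

theorem neg_le_sSup_unitValues {A : H →L[ℂ] K} (hA : A ≠ 0) (X : H →L[ℂ] K) {δ : ℝ}
    (hδ : 0 < δ) : -(‖A‖ * ‖X‖) ≤ sSup (unitValues A X δ) := by
  obtain ⟨r, hr⟩ := unitValues_nonempty hA X hδ
  exact (abs_le.1 (abs_le_of_mem_unitValues hr)).1.trans (le_csSup (bddAbove_unitValues A X δ) hr)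

theorem bddBelow_range_sSup_unitValues {A : H →L[ℂ] K} (hA : A ≠ 0) (X : H →L[ℂ] K) :
    BddBelow (Set.range fun δ : Set.Ioi (0 : ℝ) => sSup (unitValues A X δ)) :=
  ⟨-(‖A‖ * ‖X‖), by rintro _ ⟨δ, rfl⟩; exact neg_le_sSup_unitValues hA X δ.2⟩

/-- Homogeneity of degree two. The zero vector has to be allowed, since a unit vector may project to
it. -/
theorem re_inner_le_sSup_unitValues_mul (A X : H →L[ℂ] K) {δ : ℝ} {ψ : H}
    (hψ : ψ ∈ spectralRange A δ) :
    (inner ℂ (A ψ) (X ψ)).re ≤ sSup (unitValues A X δ) * ‖ψ‖ ^ 2 := by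
  rcases eq_or_ne ψ 0 with rfl | h0
  · simp
  have hn : 0 < ‖ψ‖ := norm_pos_iff.2 h0
  have hmem : (inner ℂ (A ψ) (X ψ)).re / ‖ψ‖ ^ 2 ∈ unitValues A X δ := by
    refine ⟨((‖ψ‖⁻¹ : ℝ) : ℂ) • ψ, (spectralRange A δ).smul_mem _ hψ, ?_, ?_⟩
    · rw [norm_smul, Complex.norm_real, norm_inv, norm_norm, inv_mul_cancel₀ hn.ne']
    · rw [map_smul, map_smul, inner_smul_left, inner_smul_right, Complex.conj_ofReal,
        Complex.re_ofReal_mul, Complex.re_ofReal_mul]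
      field_simp
  exact (div_le_iff₀ (by positivity)).1 (le_csSup (bddAbove_unitValues A X δ) hmem)

/-! ### Two-sided bounds for the squared norm of the perturbation -/

theorem le_norm_add_smul_sq {A : H →L[ℂ] K} (hA : A ≠ 0) (X : H →L[ℂ] K) {δ t : ℝ} (hδ : 0 < δ)
    (ht : 0 < t) :
    ‖A‖ ^ 2 - δ + 2 * t * sSup (unitValues A X δ) ≤ ‖A + (t : ℂ) • X‖ ^ 2 := by
  suffices h : sSup (unitValues A X δ) ≤ (‖A + (t : ℂ) • X‖ ^ 2 - ‖A‖ ^ 2 + δ) / (2 * t) by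
    have := (le_div_iff₀ (by positivity)).1 h
    linarith
  refine csSup_le (unitValues_nonempty hA X hδ) ?_
  rintro _ ⟨φ, hφ, hn, rfl⟩
  have hE := spectralMeasure_spec _ (ContinuousLinearMap.isPositive_adjoint_comp_self
    A).isSelfAdjoint
  have h1 := hE.le_norm_sq (ProjectionValuedMeasure.proj_apply_of_mem_range _ measurableSet_Icc hφ)
  have h2 : ‖(A + (t : ℂ) • X) φ‖ ^ 2 ≤ ‖A + (t : ℂ) • X‖ ^ 2 :=
    pow_le_pow_left₀ (norm_nonneg _) (by simpa [hn] using (A + (t : ℂ) • X).le_opNorm φ) 2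
  rw [norm_add_smul_apply_sq] at h2
  rw [hn, one_pow, mul_one] at h1
  rw [le_div_iff₀ (by positivity)]
  have h3 : 0 ≤ t ^ 2 * ‖X φ‖ ^ 2 := by positivity
  linarith

/-- The factor `3` counts three errors of size at most `‖A‖‖X‖‖φ - ψ‖`: two from replacing `φ` by
`ψ` in each slot of the form, and one from `‖ψ‖` being possibly less than `1`. -/
theorem re_inner_le_sSup_unitValues_add {A : H →L[ℂ] K} (hA : A ≠ 0) (X : H →L[ℂ] K) {δ : ℝ}
    (hδ : 0 < δ) {φ ψ : H} (hφ : ‖φ‖ = 1) (hψ : ψ ∈ spectralRange A δ)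
    (horth : ‖φ - ψ‖ ^ 2 = ‖φ‖ ^ 2 - ‖ψ‖ ^ 2) :
    (inner ℂ (A φ) (X φ)).re ≤ sSup (unitValues A X δ) + 3 * (‖A‖ * ‖X‖) * ‖φ - ψ‖ := by
  have hdec : (inner ℂ (A φ) (X φ)).re = (inner ℂ (A ψ) (X ψ)).re +
      (inner ℂ (A ψ) (X (φ - ψ))).re + (inner ℂ (A (φ - ψ)) (X φ)).re := by
    simp only [map_sub, inner_sub_left, inner_sub_right, Complex.sub_re]
    ring
  rw [hφ, one_pow] at horth
  have hM : 0 ≤ ‖A‖ * ‖X‖ := by positivity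
  have hc : ‖φ - ψ‖ ≤ 1 := by
    nlinarith [norm_nonneg (φ - ψ), sq_nonneg ‖ψ‖]
  have hψ1 : ‖ψ‖ ≤ 1 := by
    nlinarith [norm_nonneg ψ, sq_nonneg ‖φ - ψ‖]
  have h1 := re_inner_le_sSup_unitValues_mul A X hψ
  have h2 := (le_abs_self _).trans (abs_re_inner_apply_le A X ψ (φ - ψ))
  have h3 := (le_abs_self _).trans (abs_re_inner_apply_le A X (φ - ψ) φ)
  have h4 := neg_le_sSup_unitValues hA X hδ
  have h5 : ‖A‖ * ‖X‖ * (‖ψ‖ * ‖φ - ψ‖) ≤ ‖A‖ * ‖X‖ * ‖φ - ψ‖ :=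
    mul_le_mul_of_nonneg_left (mul_le_of_le_one_left (norm_nonneg _) hψ1) hM
  -- The supremum may be negative, so scaling it by `‖ψ‖² = 1 - ‖φ - ψ‖²` can increase it; its lower
  -- bound and `‖φ - ψ‖ ≤ 1` control the excess.
  have h6 : -sSup (unitValues A X δ) * ‖φ - ψ‖ ^ 2 ≤ ‖A‖ * ‖X‖ * ‖φ - ψ‖ :=
    mul_le_mul (by linarith) (by nlinarith [norm_nonneg (φ - ψ)]) (sq_nonneg _) hM
  rw [hφ, mul_one] at h3
  rw [show ‖ψ‖ ^ 2 = 1 - ‖φ - ψ‖ ^ 2 by linarith] at h1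
  linarith

theorem norm_add_smul_sq_le {A : H →L[ℂ] K} (hA : A ≠ 0) (X : H →L[ℂ] K) {δ t : ℝ} (hδ : 0 < δ)
    (ht : 0 ≤ t) :
    ‖A + (t : ℂ) • X‖ ^ 2 ≤ ‖A‖ ^ 2 + 2 * t * sSup (unitValues A X δ) +
      t ^ 2 * ((3 * (‖A‖ * ‖X‖)) ^ 2 / δ + ‖X‖ ^ 2) := by
  set s := sSup (unitValues A X δ)
  set C := 3 * (‖A‖ * ‖X‖)
  have hunit : ∀ φ : H, ‖φ‖ = 1 → ‖(A + (t : ℂ) • X) φ‖ ^ 2 ≤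
      ‖A‖ ^ 2 + 2 * t * s + t ^ 2 * (C ^ 2 / δ + ‖X‖ ^ 2) := by
    intro φ hφ
    have hE := spectralMeasure_spec _ (ContinuousLinearMap.isPositive_adjoint_comp_self
      A).isSelfAdjoint
    have h1 := hE.norm_sq_le δ φ
    have h2 := re_inner_le_sSup_unitValues_add hA X hδ hφ ⟨φ, rfl⟩
      (ProjectionValuedMeasure.norm_sub_proj_sq _ φ measurableSet_Icc)
    have h3 : ‖X φ‖ ^ 2 ≤ ‖X‖ ^ 2 :=
      pow_le_pow_left₀ (norm_nonneg _) (by simpa [hφ] using X.le_opNorm φ) 2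
    rw [hφ, one_pow, mul_one] at h1
    rw [norm_add_smul_apply_sq]
    generalize hc : ‖φ - _‖ = c at h1
    have h2' : (inner ℂ (A φ) (X φ)).re ≤ s + C * c := by rw [← hc]; exact h2
    have h4 := mul_le_mul_of_nonneg_left h2' (mul_nonneg zero_le_two ht)
    have h5 := mul_le_mul_of_nonneg_left h3 (sq_nonneg t)
    -- Completing the square in `c` absorbs the linear gain into the penalty, uniformly in `φ`.
    have h6 : 2 * t * (C * c) ≤ δ * c ^ 2 + t ^ 2 * (C ^ 2 / δ) := by
      have : δ * c ^ 2 + t ^ 2 * (C ^ 2 / δ) - 2 * t * (C * c) = (δ * c - t * C) ^ 2 / δ := by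
        field_simp
        ring
      have : 0 ≤ (δ * c - t * C) ^ 2 / δ := by positivity
      linarith
    linarith
  set R := ‖A‖ ^ 2 + 2 * t * s + t ^ 2 * (C ^ 2 / δ + ‖X‖ ^ 2)
  have hR : 0 ≤ R := by
    obtain ⟨_, φ, -, hφ, -⟩ := unitValues_nonempty hA X hδ
    exact (sq_nonneg _).trans (hunit φ hφ)
  have hn : ‖A + (t : ℂ) • X‖ ≤ √R := by
    refine ContinuousLinearMap.opNorm_le_of_unit_norm (𝕜 := ℂ) (Real.sqrt_nonneg _) fun φ hφ => ?_
    exact Real.le_sqrt_of_sq_le (hunit φ hφ)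
  exact (Real.le_sqrt (norm_nonneg _) hR).1 hn

/-! ### Passage to the limit -/

theorem tendsto_norm_add_smul_sq_slope {A : H →L[ℂ] K} (hA : A ≠ 0) (X : H →L[ℂ] K) :
    Tendsto (fun t : ℝ => (‖A + (t : ℂ) • X‖ ^ 2 - ‖A‖ ^ 2) / t) (𝓝[>] 0)
      (𝓝 (2 * ⨅ δ : Set.Ioi (0 : ℝ), sSup (unitValues A X δ))) := by
  have hbdd := bddBelow_range_sSup_unitValues hA X
  refine tendsto_order.2 ⟨fun a ha => ?_, fun b hb => ?_⟩
  · filter_upwards [self_mem_nhdsWithin] with t ht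
    -- Here `t` is fixed and `δ` is arbitrary, so the slope is at least twice the infimum for every
    -- `t > 0`, not only in the limit.
    refine ha.trans_le ((le_div_iff₀ ht).2 (le_of_forall_pos_le_add fun δ hδ => ?_))
    have h1 := le_norm_add_smul_sq hA X hδ ht
    have h2 := mul_le_mul_of_nonneg_left (ciInf_le hbdd ⟨δ, hδ⟩)
      (mul_nonneg zero_le_two (le_of_lt ht))
    simp only at h2
    linarith
  -- Here `δ` is fixed before `t → 0`, since the remainder `t(C²/δ + ‖X‖²)` is not uniform in `δ`.
  · obtain ⟨⟨δ, hδ⟩, hlt⟩ := exists_lt_of_ciInf_lt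
      (show (⨅ δ : Set.Ioi (0 : ℝ), sSup (unitValues A X δ)) < b / 2 by linarith)
    have hlim : Tendsto (fun t : ℝ => 2 * sSup (unitValues A X δ) +
        t * ((3 * (‖A‖ * ‖X‖)) ^ 2 / δ + ‖X‖ ^ 2)) (𝓝[>] 0)
        (𝓝 (2 * sSup (unitValues A X δ) + 0 * ((3 * (‖A‖ * ‖X‖)) ^ 2 / δ + ‖X‖ ^ 2))) :=
      ((continuous_const.add (continuous_id.mul continuous_const)).tendsto 0).mono_left
        nhdsWithin_le_nhds
    have hev := hlim.eventually_lt_const (u := b) (by simp only at hlt; linarith)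
    filter_upwards [hev, self_mem_nhdsWithin] with t h1 ht
    refine lt_of_le_of_lt ((div_le_iff₀ ht).2 ?_) h1
    have := norm_add_smul_sq_le hA X hδ (le_of_lt ht)
    linarith

end NormDerivative

theorem theorem2p2 {H : Type u} {K : Type v}
    [NormedAddCommGroup H] [InnerProductSpace ℂ H] [CompleteSpace H]
    [NormedAddCommGroup K] [InnerProductSpace ℂ K] [CompleteSpace K]
    (A X : H →L[ℂ] K) (hA : A ≠ 0) :
    (∀ δ : ℝ, 0 < δ → (unitValues A X δ).Nonempty ∧ BddAbove (unitValues A X δ)) ∧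
    BddBelow (Set.range fun δ : Set.Ioi (0 : ℝ) => sSup (unitValues A X δ)) ∧
    Tendsto (fun t : ℝ => (‖A + (t : ℂ) • X‖ - ‖A‖) / t) (𝓝[>] 0)
      (𝓝 (1 / ‖A‖ * ⨅ δ : Set.Ioi (0 : ℝ), sSup (unitValues A X δ))) := by
  refine ⟨fun δ hδ => ⟨unitValues_nonempty hA X hδ, bddAbove_unitValues A X δ⟩,
    bddBelow_range_sSup_unitValues hA X, ?_⟩
  have hN : 0 < ‖A‖ := norm_pos_iff.2 hA
  have hcont : Continuous fun t : ℝ => ‖A + (t : ℂ) • X‖ + ‖A‖ := by fun_prop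
  have hden : Tendsto (fun t : ℝ => ‖A + (t : ℂ) • X‖ + ‖A‖) (𝓝[>] 0) (𝓝 (‖A‖ + ‖A‖)) := by
    have h := hcont.tendsto 0
    simp only [Complex.ofReal_zero, zero_smul, add_zero] at h
    exact h.mono_left nhdsWithin_le_nhds
  -- The slope of the norm is the slope of its square divided by the sum of the two norms.
  have h := (tendsto_norm_add_smul_sq_slope hA X).div hden (by positivity)
  have hlim : (2 * ⨅ δ : Set.Ioi (0 : ℝ), sSup (unitValues A X δ)) / (‖A‖ + ‖A‖) =
      1 / ‖A‖ * ⨅ δ : Set.Ioi (0 : ℝ), sSup (unitValues A X δ) := by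
    field_simp
    ring
  rw [hlim] at h
  refine h.congr fun t => ?_
  have hpos : ‖A + (t : ℂ) • X‖ + ‖A‖ ≠ 0 := by positivity
  rw [Pi.div_apply, sq_sub_sq, div_right_comm, mul_div_cancel_left₀ _ hpos]
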